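/- For a domain $\Omega\subset\mathbb C$, a point $p\in\Omega$ and $\xi\in\mathbb C$, the Kobayashi metric is $$F_K^\Omega(p,\xi)=\inf\{\alpha>0:\ \text{there is a holomorphic } f:\Delta\to\Omega \text{ with } f(0)=p,\ \alpha f'(0)=\xi\},$$ where $\Delta$ is the open unit disc. Let $U\subset\mathbb C$ be a domain (a nonempty connected open set), let $J\subset U$ be a set with at least two points and with no limit point in $U$, and let $\Omega=U\setminus J$. Then for every $p_j\in J$ there are constants $c,C>0$ and $\delta_0\in(0,1)$, depending only on $U$, $J$ and $p_j$, such that for all $p\in\Omega$ with $\delta:=|p-p_j|<\delta_0$ and all $\xi\in\mathbb C$ with $|\xi|=1$, $$\frac{c}{\delta\log(1/\delta)}\le F_K^{\Omega}(p,\xi)\le\frac{C}{\delta\log(1/\delta)}.$$ -/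

import Mathlib

/-- The Kobayashi (pseudo)metric of a set `Ω` at the point `p` in the direction `ξ`:
the infimum of all `α > 0` for which some holomorphic map `f` from the open unit disc
into `Ω` has `f 0 = p` and `α f'(0) = ξ`. -/
noncomputable def kobayashiMetric {E : Type*} [NormedAddCommGroup E] [NormedSpace ℂ E]
    (Ω : Set E) (p ξ : E) : ℝ :=
  sInf {α : ℝ | 0 < α ∧ ∃ f : ℂ → E, DifferentiableOn ℂ f (Metric.ball 0 1) ∧
    Set.MapsTo f (Metric.ball 0 1) Ω ∧ f 0 = p ∧ (α : ℂ) • deriv f 0 = ξ}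

/-- For an open set `Ω`, a point of it and any direction, the infimum that defines the
Kobayashi metric is taken over a nonempty set (which is bounded below by `0`). -/
theorem kobayashiMetric_candidates_nonempty {E : Type*} [NormedAddCommGroup E]
    [NormedSpace ℂ E] {Ω : Set E} (hΩ : IsOpen Ω) {p : E} (hp : p ∈ Ω) (ξ : E) :
    {α : ℝ | 0 < α ∧ ∃ f : ℂ → E, DifferentiableOn ℂ f (Metric.ball 0 1) ∧
      Set.MapsTo f (Metric.ball 0 1) Ω ∧ f 0 = p ∧ (α : ℂ) • deriv f 0 = ξ}.Nonempty := by
  obtain ⟨r, hr, hball⟩ := Metric.isOpen_iff.1 hΩ p hp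
  have hn : 0 < ‖ξ‖ + 1 := by positivity
  have ht : 0 < r / (‖ξ‖ + 1) := by positivity
  set t : ℝ := r / (‖ξ‖ + 1) with htd
  have hd : ∀ z : ℂ, HasDerivAt (fun z : ℂ => p + z • ((t : ℂ) • ξ)) ((t : ℂ) • ξ) z := by
    intro z
    simpa using ((hasDerivAt_id z).smul_const ((t : ℂ) • ξ)).const_add p
  refine ⟨t⁻¹, inv_pos.2 ht, fun z => p + z • ((t : ℂ) • ξ),
    fun z _ => (hd z).differentiableAt.differentiableWithinAt, ?_, by simp, ?_⟩
  · intro z hz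
    apply hball
    have hz1 : ‖z‖ < 1 := by simpa using hz
    have h1 : t * ‖ξ‖ < r := by
      have h2 : t * (‖ξ‖ + 1) = r := by rw [htd]; field_simp
      nlinarith
    have h3 : 0 ≤ t * ‖ξ‖ := by positivity
    have h4 : ‖z‖ * (t * ‖ξ‖) < r := by nlinarith [norm_nonneg z]
    simpa [Metric.mem_ball, dist_eq_norm, norm_smul, abs_of_pos ht] using h4
  · have hc : (t : ℂ) ≠ 0 := by exact_mod_cast ht.ne'
    rw [(hd 0).deriv, smul_smul]
    push_cast
    rw [inv_mul_cancel₀ hc, one_smul]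

/-! Both bounds come from the behaviour of the hyperbolic metric near a puncture. For the upper
bound, `q` is isolated in `J`, so `U \ J` contains a punctured disc about `q`, whose universal
covering is a competitor with `|f'(0)| = 2 δ log (r/δ)`.

For the lower bound, any competitor omits `q` and a second point of `J`; normalise these to `0` and
`1`. Landau's theorem, in the form `|f'(0)| ≤ C |f(0)| (|log |f(0)|| + C')`, then gives the right
order. It follows from Bloch's theorem: `h = log f / (2πi)` omits the integers, and `h = cosh² g`
with `g` omitting a net of the plane, so `|g'(0)|` is bounded. -/

/-! ### Bloch's theorem -/

/-- Bloch's theorem, with a non-optimal constant: a holomorphic function on the unit disc whose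
image contains no disc of radius `R` has derivative at most `48 * R` at the origin. -/
theorem norm_deriv_zero_le_of_omits {f : ℂ → ℂ} {R : ℝ} (hR : 0 < R)
    (hf : DifferentiableOn ℂ f (Metric.ball 0 1))
    (homit : ∀ w, ∃ v ∈ Metric.ball w R, v ∉ f '' Metric.ball 0 1) :
    ‖deriv f 0‖ ≤ 48 * R := by
  by_contra! hlt
  have hA0 : 0 < ‖deriv f 0‖ := by linarith
  obtain ⟨r, hr1, hr2⟩ : ∃ r, 48 * R / ‖deriv f 0‖ < r ∧ r < 1 :=
    exists_between ((div_lt_one hA0).2 hlt)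
  have hr0 : 0 < r := lt_trans (by positivity) hr1
  rw [div_lt_iff₀ hA0] at hr1
  have hsub : Metric.closedBall (0 : ℂ) r ⊆ Metric.ball 0 1 := Metric.closedBall_subset_ball hr2
  have hf' : DifferentiableOn ℂ (deriv f) (Metric.ball 0 1) := hf.deriv Metric.isOpen_ball
  -- Maximality of `|f'(z)| (r - |z|)` at `a` gives `|f'| ≤ 2 |f'(a)|` on the ball of half the
  -- distance to the circle `|z| = r`.
  obtain ⟨a, ha, hmax⟩ := (isCompact_closedBall (0 : ℂ) r).exists_isMaxOn
    (f := fun z => ‖deriv f z‖ * (r - ‖z‖)) ⟨0, by simp [hr0.le]⟩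
    (((hf'.mono hsub).continuousOn.norm).mul (by fun_prop))
  have hmax' : ∀ z, ‖z‖ ≤ r → ‖deriv f z‖ * (r - ‖z‖) ≤ ‖deriv f a‖ * (r - ‖a‖) :=
    fun z hz => hmax (by simpa using hz)
  have ha' : ‖a‖ ≤ r := by simpa using ha
  have hM : 48 * R < ‖deriv f a‖ * (r - ‖a‖) := by
    have := hmax' 0 (by simpa using hr0.le)
    simp only [norm_zero, sub_zero] at this
    linarith
  have hpos : 0 < ‖deriv f a‖ * (r - ‖a‖) := by linarith
  have hA : 0 < ‖deriv f a‖ := by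
    rcases (norm_nonneg (deriv f a)).eq_or_lt with h | h
    · rw [← h] at hpos; simp at hpos
    · exact h
  have hra : 0 < r - ‖a‖ := (pos_iff_pos_of_mul_pos hpos).1 hA
  set A := ‖deriv f a‖ with hAdef
  set t := (r - ‖a‖) / 2 with ht
  have ht0 : 0 < t := by positivity
  have hball : ∀ z ∈ Metric.ball a t, ‖z‖ < r - t := by
    intro z hz
    rw [mem_ball_iff_norm] at hz
    have : ‖z‖ ≤ ‖a‖ + ‖z - a‖ := by simpa using norm_add_le a (z - a)
    linarith
  have hballsub : Metric.ball a t ⊆ Metric.ball 0 1 := fun z hz => by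
    have := hball z hz
    rw [mem_ball_zero_iff]; linarith
  have hbound : ∀ z ∈ Metric.ball a t, ‖deriv f z‖ ≤ 2 * A := by
    intro z hz
    have h1 := hball z hz
    have h2 := hmax' z (by linarith)
    have h3 : ‖deriv f z‖ * t ≤ ‖deriv f z‖ * (r - ‖z‖) := by gcongr; linarith
    have h4 : r - ‖a‖ = 2 * t := by rw [ht]; ring
    rw [h4] at h2
    have h5 : ‖deriv f z‖ * t ≤ (2 * A) * t := by linarith
    exact le_of_mul_le_mul_right h5 ht0
  -- Schwarz lemma for `f'`, which stays within `3A` of `f'(a)`.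
  have hlip : ∀ z ∈ Metric.ball a t, ‖deriv f z - deriv f a‖ ≤ 3 * A / t * ‖z - a‖ := by
    intro z hz
    have := Complex.dist_le_div_mul_dist_of_mapsTo_ball (hf'.mono hballsub) (R₂ := 3 * A)
      (fun w hw => by
        rw [mem_closedBall_iff_norm]
        have := norm_sub_le (deriv f w) (deriv f a)
        have := hbound w hw
        linarith) hz
    simpa [dist_eq_norm] using this
  -- With this radius `|f' - f'(a)| ≤ A / 2`, so the linear part of `f` dominates on the circle and
  -- the image contains a disc of radius `A s / 4 = A (r - |a|) / 48`.
  set s := t / 6 with hs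
  have hs0 : 0 < s := by positivity
  have hst : Metric.closedBall a s ⊆ Metric.ball a t :=
    Metric.closedBall_subset_ball (by linarith)
  have hdiff : ∀ z ∈ Metric.closedBall a s, DifferentiableAt ℂ f z := fun z hz =>
    hf.differentiableAt (Metric.isOpen_ball.mem_nhds (hballsub (hst hz)))
  have hsphere : ∀ z ∈ Metric.sphere a s, A * s / 2 ≤ ‖f z - f a‖ := by
    intro z hz
    have hz' := Metric.sphere_subset_closedBall hz
    have hmv := (convex_closedBall a s).norm_image_sub_le_of_norm_hasDerivWithin_le
      (f := fun w => f w - deriv f a * w) (f' := fun w => deriv f w - deriv f a) (C := A / 2)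
      (fun w hw => by
        have h := ((hdiff w hw).hasDerivAt.sub ((hasDerivAt_id w).const_mul (deriv f a)))
        exact (h.congr_deriv (by simp)).hasDerivWithinAt)
      (fun w hw => by
        refine (hlip w (hst hw)).trans ?_
        have h1 : ‖w - a‖ ≤ s := by simpa [dist_eq_norm] using hw
        calc 3 * A / t * ‖w - a‖ ≤ 3 * A / t * s := by gcongr
          _ = A / 2 := by rw [hs]; field_simp; norm_num)
      (Metric.mem_closedBall_self hs0.le) hz'
    have hzs : ‖z - a‖ = s := by simpa [dist_eq_norm] using hz
    have h2 : ‖deriv f a * (z - a)‖ = A * s := by rw [norm_mul, hzs]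
    have h3 := norm_sub_le (f z - f a) ((f z - deriv f a * z) - (f a - deriv f a * a))
    have h4 : f z - f a - ((f z - deriv f a * z) - (f a - deriv f a * a))
      = deriv f a * (z - a) := by ring
    rw [h4, h2] at h3
    rw [hzs] at hmv
    linarith
  have hne : ∃ᶠ z in nhds a, f z ≠ f a := by
    have h := ((hdiff a (Metric.mem_closedBall_self hs0.le)).hasDerivAt).eventually_ne
      (c := f a) (norm_pos_iff.1 hA)
    exact h.frequently.filter_mono nhdsWithin_le_nhds
  have hcont : DiffContOnCl ℂ f (Metric.ball a s) :=
    DifferentiableOn.diffContOnCl_ball (U := Metric.closedBall a s)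
      (fun z hz => (hdiff z hz).differentiableWithinAt) le_rfl
  have himg := hcont.ball_subset_image_closedBall hs0 hsphere hne
  obtain ⟨v, hv, hvn⟩ := homit (f a)
  have hRs : R ≤ A * s / 2 / 2 := by
    have : A * (r - ‖a‖) = 48 * (A * s / 2 / 2) := by rw [hs, ht]; ring
    linarith
  obtain ⟨z, hz, rfl⟩ := himg (Metric.ball_subset_ball hRs hv)
  exact hvn ⟨z, hballsub (hst hz), rfl⟩

/-! ### Landau's theorem -/

/-- A holomorphic branch of the logarithm of a zero-free function on the unit disc, normalised
at the origin. -/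
theorem exists_log_of_ne_zero_on_unit_ball {f : ℂ → ℂ}
    (hf : DifferentiableOn ℂ f (Metric.ball 0 1)) (h0 : ∀ z ∈ Metric.ball (0 : ℂ) 1, f z ≠ 0) :
    ∃ F : ℂ → ℂ, DifferentiableOn ℂ F (Metric.ball 0 1) ∧
      (∀ z ∈ Metric.ball (0 : ℂ) 1, Complex.exp (F z) = f z) ∧ F 0 = Complex.log (f 0) := by
  have hmem : (0 : ℂ) ∈ Metric.ball (0 : ℂ) 1 := by simp
  have hf' : DifferentiableOn ℂ (deriv f) (Metric.ball 0 1) := hf.deriv Metric.isOpen_ball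
  obtain ⟨G, hG⟩ := (hf'.div hf h0).isExactOn_ball
  have hGd : DifferentiableOn ℂ G (Metric.ball 0 1) := fun z hz =>
    (hG z hz).differentiableAt.differentiableWithinAt
  have hconst : ∀ z ∈ Metric.ball (0 : ℂ) 1,
      f z * Complex.exp (-G z) = f 0 * Complex.exp (-G 0) := by
    intro z hz
    have := (convex_ball (0 : ℂ) 1).norm_image_sub_le_of_norm_hasDerivWithin_le
      (f := fun w => f w * Complex.exp (-G w)) (f' := fun _ => 0) (C := 0)
      (fun w hw => by
        have h1 := (hf.differentiableAt (Metric.isOpen_ball.mem_nhds hw)).hasDerivAt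
        have h2 := h1.mul (hG w hw).neg.cexp
        refine (h2.congr_deriv ?_).hasDerivWithinAt
        have := h0 w hw
        simp only [Pi.div_apply]
        field_simp
        ring)
      (fun w _ => by simp) hmem hz
    rw [zero_mul, norm_le_zero_iff, sub_eq_zero] at this
    exact this
  refine ⟨fun z => G z - G 0 + Complex.log (f 0), (hGd.sub_const _).add_const _, ?_, by simp⟩
  intro z hz
  have h1 := hconst z hz
  rw [Complex.exp_add, Complex.exp_log (h0 0 hmem), sub_eq_add_neg, Complex.exp_add]
  rw [Complex.exp_neg, ← div_eq_mul_inv, div_eq_iff (Complex.exp_ne_zero _)] at h1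
  rw [h1]; ring

/-- The points at which `cosh ^ 2` is an integer form a `5`-net of the plane. -/
theorem exists_cosh_sq_eq_int_near (w : ℂ) :
    ∃ v ∈ Metric.ball w 5, ∃ n : ℤ, Complex.cosh v ^ 2 = n := by
  -- On the half-line `cosh²` grows by at least `1` over length `2`, so it takes an integer value
  -- there; vertically, `cosh²` has period `πi`.
  have hreal : ∀ y : ℝ, 0 ≤ y → ∃ x, y ≤ x ∧ x ≤ y + 2 ∧ ∃ n : ℤ, Real.cosh x ^ 2 = n := by
    intro y hy
    have hstep : Real.cosh y ^ 2 + 1 ≤ Real.cosh (y + 2) ^ 2 := by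
      rw [Real.cosh_add]
      have h1 := Real.one_le_cosh y
      have h2 := Real.sinh_nonneg_iff.2 hy
      have h3 : 0 ≤ Real.sinh 2 := Real.sinh_nonneg_iff.2 (by norm_num)
      have h4 : 2 ≤ Real.cosh 2 := by
        rw [Real.cosh_eq]
        have := Real.quadratic_le_exp_of_nonneg (x := 2) (by norm_num)
        have := Real.exp_pos (-2)
        linarith
      have h5 : 0 ≤ Real.sinh y * Real.sinh 2 := by positivity
      have h6 : Real.cosh y * 2 ≤ Real.cosh y * Real.cosh 2 := by gcongr
      nlinarith
    have hc : ContinuousOn (fun x => Real.cosh x ^ 2) (Set.Icc y (y + 2)) :=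
      (Real.continuous_cosh.pow 2).continuousOn
    obtain ⟨x, hx, hxn⟩ := intermediate_value_Icc (by linarith : y ≤ y + 2) hc
      (show (⌈Real.cosh y ^ 2⌉ : ℝ) ∈ _ from
        ⟨Int.le_ceil _, (Int.ceil_lt_add_one _).le.trans hstep⟩)
    exact ⟨x, hx.1, hx.2, _, hxn⟩
  obtain ⟨x, hx, n, hn⟩ : ∃ x : ℝ, |x - w.re| ≤ 2 ∧ ∃ n : ℤ, Real.cosh x ^ 2 = n := by
    rcases le_total 0 w.re with h | h
    · obtain ⟨x, h1, h2, h3⟩ := hreal _ h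
      exact ⟨x, abs_le.2 ⟨by linarith, by linarith⟩, h3⟩
    · obtain ⟨x, h1, h2, h3⟩ := hreal (-w.re) (by linarith)
      exact ⟨-x, abs_le.2 ⟨by linarith, by linarith⟩, by simpa using h3⟩
  set m := round (w.im / Real.pi)
  have hm : |m * Real.pi - w.im| ≤ 2 := by
    have h1 := abs_sub_round (w.im / Real.pi)
    have h2 : m * Real.pi - w.im = -((w.im / Real.pi - m) * Real.pi) := by
      field_simp [Real.pi_ne_zero]; ring
    rw [h2, abs_neg, abs_mul, abs_of_pos Real.pi_pos]
    calc _ ≤ 1 / 2 * Real.pi := by gcongr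
      _ ≤ 2 := by linarith [Real.pi_le_four]
  refine ⟨x + (m * Real.pi : ℂ) * Complex.I, ?_, n, ?_⟩
  · rw [mem_ball_iff_norm]
    refine (Complex.norm_le_abs_re_add_abs_im _).trans_lt ?_
    have h1 : (x + (m * Real.pi : ℂ) * Complex.I - w).re = x - w.re := by simp
    have h2 : (x + (m * Real.pi : ℂ) * Complex.I - w).im = m * Real.pi - w.im := by simp
    rw [h1, h2]; linarith
  · have hs : Complex.sin (m * Real.pi) = 0 := Complex.sin_int_mul_pi m
    rw [Complex.cosh_add, Complex.cosh_mul_I, Complex.sinh_mul_I, hs]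
    have hc : Complex.cos (m * Real.pi) ^ 2 = 1 := by
      have := Complex.sin_sq_add_cos_sq (m * Real.pi)
      rw [hs] at this; simpa using this
    rw [zero_mul, mul_zero, add_zero, mul_pow, hc, mul_one]
    exact_mod_cast hn

/-- A holomorphic function on the unit disc that omits the integers has derivative at the origin
bounded linearly in its value there. -/
theorem norm_deriv_zero_le_of_ne_int {h : ℂ → ℂ}
    (hd : DifferentiableOn ℂ h (Metric.ball 0 1))
    (hn : ∀ z ∈ Metric.ball (0 : ℂ) 1, ∀ n : ℤ, h z ≠ n) :
    ‖deriv h 0‖ ≤ 480 * (‖h 0‖ + 1) := by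
  have hmem : (0 : ℂ) ∈ Metric.ball (0 : ℂ) 1 := by simp
  obtain ⟨P, hPd, hP, -⟩ := exists_log_of_ne_zero_on_unit_ball hd
    (fun z hz => by simpa using hn z hz 0)
  obtain ⟨Q, hQd, hQ, -⟩ := exists_log_of_ne_zero_on_unit_ball (hd.sub_const 1)
    (fun z hz => sub_ne_zero.2 (by simpa using hn z hz 1))
  -- Since `u² - v² = 1`, a logarithm `g` of `u - v` satisfies `cosh g = u` and `sinh g = -v`, hence
  -- `h = cosh² g`.
  set u : ℂ → ℂ := fun z => Complex.exp (P z / 2) with hu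
  set v : ℂ → ℂ := fun z => Complex.exp (Q z / 2) with hv
  have hu2 : ∀ z ∈ Metric.ball (0 : ℂ) 1, u z ^ 2 = h z := fun z hz => by
    rw [hu, ← hP z hz, ← Complex.exp_nat_mul]; congr 1; push_cast; ring
  have hv2 : ∀ z ∈ Metric.ball (0 : ℂ) 1, v z ^ 2 = h z - 1 := fun z hz => by
    rw [hv, ← hQ z hz, ← Complex.exp_nat_mul]; congr 1; push_cast; ring
  have hud : DifferentiableOn ℂ u (Metric.ball 0 1) := (hPd.div_const 2).cexp
  have hvd : DifferentiableOn ℂ v (Metric.ball 0 1) := (hQd.div_const 2).cexp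
  have hprod : ∀ z ∈ Metric.ball (0 : ℂ) 1, (u z - v z) * (u z + v z) = 1 := fun z hz => by
    linear_combination hu2 z hz - hv2 z hz
  obtain ⟨g, hgd, hg, -⟩ := exists_log_of_ne_zero_on_unit_ball (hud.sub hvd)
    (fun z hz => left_ne_zero_of_mul_eq_one (hprod z hz))
  have hgn : ∀ z ∈ Metric.ball (0 : ℂ) 1, Complex.exp (-g z) = u z + v z := fun z hz => by
    rw [Complex.exp_neg, hg z hz]
    exact inv_eq_of_mul_eq_one_right (hprod z hz)
  have hcosh : ∀ z ∈ Metric.ball (0 : ℂ) 1, Complex.cosh (g z) = u z := fun z hz => by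
    rw [Complex.cosh, hg z hz, hgn z hz]
    simp only [Pi.sub_apply]
    ring
  have hsinh : ∀ z ∈ Metric.ball (0 : ℂ) 1, Complex.sinh (g z) = -v z := fun z hz => by
    rw [Complex.sinh, hg z hz, hgn z hz]
    simp only [Pi.sub_apply]
    ring
  have hbloch : ‖deriv g 0‖ ≤ 48 * 5 := by
    refine norm_deriv_zero_le_of_omits (by norm_num) hgd fun w => ?_
    obtain ⟨y, hy, n, hyn⟩ := exists_cosh_sq_eq_int_near w
    refine ⟨y, hy, ?_⟩
    rintro ⟨z, hz, rfl⟩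
    rw [hcosh z hz, hu2 z hz] at hyn
    exact hn z hz n hyn
  have hderiv : deriv h 0 = 2 * u 0 * (-v 0 * deriv g 0) := by
    have hg0 := (hgd.differentiableAt (Metric.isOpen_ball.mem_nhds hmem)).hasDerivAt
    have h1 := (hg0.ccosh).pow 2
    have h2 : h =ᶠ[nhds 0] fun z => Complex.cosh (g z) ^ 2 := by
      filter_upwards [Metric.isOpen_ball.mem_nhds hmem] with z hz
      rw [hcosh z hz, hu2 z hz]
    rw [h2.deriv_eq]
    refine h1.deriv.trans ?_
    rw [hcosh 0 hmem, hsinh 0 hmem]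
    simp
  have hun : ‖u 0‖ ^ 2 = ‖h 0‖ := by rw [← norm_pow, hu2 0 hmem]
  have hvn : ‖v 0‖ ^ 2 ≤ ‖h 0‖ + 1 := by
    rw [← norm_pow, hv2 0 hmem]
    simpa using norm_sub_le (h 0) 1
  have huv : 2 * (‖u 0‖ * ‖v 0‖) ≤ 2 * (‖h 0‖ + 1) := by
    nlinarith [sq_nonneg (‖u 0‖ - ‖v 0‖)]
  calc ‖deriv h 0‖ = 2 * (‖u 0‖ * ‖v 0‖) * ‖deriv g 0‖ := by
        rw [hderiv]; simp only [norm_mul, norm_neg, Complex.norm_ofNat]; ring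
    _ ≤ 2 * (‖h 0‖ + 1) * (48 * 5) := by gcongr
    _ = 480 * (‖h 0‖ + 1) := by ring

/-- A quantitative form of Landau's theorem for holomorphic functions on the unit disc that omit
`0` and `1`. -/
theorem norm_deriv_zero_le_of_ne_zero_of_ne_one {f : ℂ → ℂ}
    (hd : DifferentiableOn ℂ f (Metric.ball 0 1))
    (h0 : ∀ z ∈ Metric.ball (0 : ℂ) 1, f z ≠ 0) (h1 : ∀ z ∈ Metric.ball (0 : ℂ) 1, f z ≠ 1) :
    ‖deriv f 0‖ ≤ 480 * ‖f 0‖ * (|Real.log ‖f 0‖| + 3 * Real.pi) := by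
  have hmem : (0 : ℂ) ∈ Metric.ball (0 : ℂ) 1 := by simp
  obtain ⟨F, hFd, hF, hF0⟩ := exists_log_of_ne_zero_on_unit_ball hd h0
  have hpi := Complex.two_pi_I_ne_zero
  have hpin : ‖(2 * Real.pi * Complex.I : ℂ)‖ = 2 * Real.pi := by
    simp [abs_of_pos Real.pi_pos]
  have hL := norm_deriv_zero_le_of_ne_int (hFd.div_const (2 * Real.pi * Complex.I))
    (fun z hz n hzn => h1 z hz (by
      rw [← hF z hz, Complex.exp_eq_one_iff]
      exact ⟨n, (div_eq_iff hpi).1 hzn⟩))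
  have hF' := (hFd.differentiableAt (Metric.isOpen_ball.mem_nhds hmem)).hasDerivAt
  have hderiv : deriv f 0 = f 0 * deriv F 0 := by
    have h2 : f =ᶠ[nhds 0] fun z => Complex.exp (F z) := by
      filter_upwards [Metric.isOpen_ball.mem_nhds hmem] with z hz
      rw [hF z hz]
    rw [h2.deriv_eq, hF'.cexp.deriv, hF 0 hmem]
  rw [deriv_div_const, norm_div, norm_div, hpin, hF0, div_le_iff₀ (by positivity)] at hL
  have hlog : ‖Complex.log (f 0)‖ ≤ |Real.log ‖f 0‖| + Real.pi := by
    refine (Complex.norm_le_abs_re_add_abs_im _).trans ?_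
    rw [Complex.log_re, Complex.log_im]
    gcongr
    exact Complex.abs_arg_le_pi _
  have hL' : ‖deriv F 0‖ ≤ 480 * (‖Complex.log (f 0)‖ + 2 * Real.pi) := by
    refine hL.trans_eq ?_
    field_simp
  rw [hderiv, norm_mul]
  calc ‖f 0‖ * ‖deriv F 0‖
      ≤ ‖f 0‖ * (480 * (|Real.log ‖f 0‖| + Real.pi + 2 * Real.pi)) := by
        gcongr; exact hL'.trans (by gcongr)
    _ = _ := by ring

/-! ### Upper bound: the covering of a punctured disc -/

/-- The Cayley transform `(1 + w) / (1 - w)` maps the disc to the right half-plane; subtracting `1`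
makes it vanish at the origin. -/
theorem neg_one_lt_re_two_mul_div_one_sub {w : ℂ} (hw : ‖w‖ < 1) :
    -1 < (2 * w / (1 - w)).re := by
  have hne : 1 - w ≠ 0 := by
    intro h
    rw [sub_eq_zero] at h
    rw [← h] at hw
    simp at hw
  have h1 : 2 * w / (1 - w) = (1 + w) / (1 - w) - 1 := by field_simp; ring
  have h2 : w.re * w.re + w.im * w.im < 1 := by
    rw [← Complex.normSq_apply, Complex.normSq_eq_norm_sq]
    nlinarith [norm_nonneg w]
  have h3 : 0 < ((1 + w) / (1 - w)).re := by
    rw [Complex.div_re, ← add_div]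
    refine div_pos ?_ (Complex.normSq_pos.2 hne)
    simp only [Complex.add_re, Complex.sub_re, Complex.one_re, Complex.add_im, Complex.sub_im,
      Complex.one_im]
    nlinarith
  rw [h1, Complex.sub_re, Complex.one_re]
  linarith

theorem kobayashiMetric_candidates_bddBelow {E : Type*} [NormedAddCommGroup E]
    [NormedSpace ℂ E] (Ω : Set E) (p ξ : E) :
    BddBelow {α : ℝ | 0 < α ∧ ∃ f : ℂ → E, DifferentiableOn ℂ f (Metric.ball 0 1) ∧
      Set.MapsTo f (Metric.ball 0 1) Ω ∧ f 0 = p ∧ (α : ℂ) • deriv f 0 = ξ} :=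
  ⟨0, fun _ h => h.1.le⟩

/-- The universal covering of a punctured disc provides a competitor for the Kobayashi metric. -/
theorem exists_holomorphic_disc_in_punctured_ball {q p ξ : ℂ} {r : ℝ} (hr : 0 < r) (hpq : p ≠ q)
    (hpr : dist p q < r) (hξ : ‖ξ‖ = 1) :
    ∃ f : ℂ → ℂ, DifferentiableOn ℂ f (Metric.ball 0 1) ∧
      Set.MapsTo f (Metric.ball 0 1) (Metric.ball q r \ {q}) ∧ f 0 = p ∧
      ((1 / (2 * (dist p q * Real.log (r / dist p q))) : ℝ) : ℂ) • deriv f 0 = ξ := by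
  have hδ : 0 < dist p q := dist_pos.2 hpq
  have ha : p - q ≠ 0 := sub_ne_zero.2 hpq
  have han : ‖p - q‖ = dist p q := (dist_eq_norm _ _).symm
  set δ := dist p q with hδdef
  set L := Real.log (r / δ) with hLdef
  have hL : 0 < L := Real.log_pos ((one_lt_div hδ).2 hpr)
  -- A unimodular rotation of the disc that makes the derivative at `0` equal to `2 δ L ξ`.
  set e : ℂ := -(ξ * δ / (p - q)) with he
  have hen : ‖e‖ = 1 := by
    rw [he, norm_neg, norm_div, norm_mul, hξ, han, Complex.norm_real, Real.norm_of_nonneg hδ.le]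
    field_simp
  have hez : ∀ z ∈ Metric.ball (0 : ℂ) 1, ‖e * z‖ < 1 := fun z hz => by
    rw [norm_mul, hen, one_mul]; simpa using hz
  have hne : ∀ z ∈ Metric.ball (0 : ℂ) 1, 1 - e * z ≠ 0 := fun z hz h => by
    have := hez z hz
    rw [← sub_eq_zero.1 h] at this
    simp at this
  have hda : ∀ z ∈ Metric.ball (0 : ℂ) 1,
      HasDerivAt (fun z => q + (p - q) * Complex.exp (-L * (2 * (e * z) / (1 - e * z))))
        ((p - q) * (Complex.exp (-L * (2 * (e * z) / (1 - e * z))) *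
          (-L * (2 * e / (1 - e * z) ^ 2)))) z := by
    intro z hz
    have h1 : HasDerivAt (fun z : ℂ => e * z) e z := by
      simpa using (hasDerivAt_id z).const_mul e
    have h2 := ((h1.const_mul 2).div (h1.const_sub 1) (hne z hz)).const_mul (-L : ℂ)
    refine ((h2.cexp.const_mul (p - q)).const_add q).congr_deriv ?_
    have := hne z hz
    simp only [Pi.div_apply]
    field_simp
    ring
  refine ⟨_, fun z hz => (hda z hz).differentiableAt.differentiableWithinAt, ?_, by simp, ?_⟩
  · intro z hz
    refine ⟨?_, ?_⟩
    · rw [mem_ball_iff_norm, add_sub_cancel_left, norm_mul, han, Complex.norm_exp]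
      have h1 := neg_one_lt_re_two_mul_div_one_sub (hez z hz)
      have h2 : (-(L : ℂ) * (2 * (e * z) / (1 - e * z))).re
          = -L * (2 * (e * z) / (1 - e * z)).re := by
        rw [← Complex.ofReal_neg, Complex.re_ofReal_mul]
      rw [h2]
      have h3 : -L * (2 * (e * z) / (1 - e * z)).re < L := by nlinarith
      calc _ < δ * Real.exp L := by gcongr
        _ = r := by rw [hLdef, Real.exp_log (by positivity)]; field_simp
    · simp [ha]
  · rw [(hda 0 (by simp)).deriv]
    have hδ' : (δ : ℂ) ≠ 0 := by exact_mod_cast hδ.ne'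
    have hL' : (L : ℂ) ≠ 0 := by exact_mod_cast hL.ne'
    rw [he]
    push_cast
    simp only [mul_zero, sub_zero, zero_div, Complex.exp_zero, smul_eq_mul]
    field_simp

theorem kobayashiMetric_le_of_punctured_ball_subset {Ω : Set ℂ} {q p ξ : ℂ} {r : ℝ} (hr : 0 < r)
    (hΩ : Metric.ball q r \ {q} ⊆ Ω) (hpq : p ≠ q) (hpr : dist p q < r) (hξ : ‖ξ‖ = 1) :
    kobayashiMetric Ω p ξ ≤ 1 / (2 * (dist p q * Real.log (r / dist p q))) := by
  obtain ⟨f, hf, hfm, hf0, hf'⟩ := exists_holomorphic_disc_in_punctured_ball hr hpq hpr hξ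
  have hδ : 0 < dist p q := dist_pos.2 hpq
  have hL : 0 < Real.log (r / dist p q) := Real.log_pos ((one_lt_div hδ).2 hpr)
  exact csInf_le (kobayashiMetric_candidates_bddBelow Ω p ξ)
    ⟨by positivity, f, hf, hfm.mono_right hΩ, hf0, hf'⟩

/-! ### Lower bound: two omitted points -/

theorem norm_deriv_zero_le_of_omits_two_points {q q' : ℂ} (hqq : q' ≠ q) {f : ℂ → ℂ}
    (hf : DifferentiableOn ℂ f (Metric.ball 0 1))
    (h0 : ∀ z ∈ Metric.ball (0 : ℂ) 1, f z ≠ q) (h1 : ∀ z ∈ Metric.ball (0 : ℂ) 1, f z ≠ q') :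
    ‖deriv f 0‖ ≤
      480 * dist (f 0) q * (|Real.log (dist (f 0) q / dist q' q)| + 3 * Real.pi) := by
  have hd : q' - q ≠ 0 := sub_ne_zero.2 hqq
  have hdn : 0 < ‖q' - q‖ := norm_pos_iff.2 hd
  have h := norm_deriv_zero_le_of_ne_zero_of_ne_one ((hf.sub_const q).div_const (q' - q))
    (fun z hz => div_ne_zero (sub_ne_zero.2 (h0 z hz)) hd)
    (fun z hz hz1 => h1 z hz (by
      rw [div_eq_one_iff_eq hd] at hz1
      exact sub_left_injective hz1))
  rw [deriv_div_const, deriv_sub_const_fun, norm_div, norm_div, div_le_iff₀ hdn] at h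
  rw [dist_eq_norm, dist_eq_norm]
  refine h.trans_eq ?_
  field_simp

theorem le_kobayashiMetric_of_omits_two_points {Ω : Set ℂ} (hΩ : IsOpen Ω) {q q' p ξ : ℂ}
    (hqq : q' ≠ q) (hq : q ∉ Ω) (hq' : q' ∉ Ω) (hp : p ∈ Ω) (hξ : ‖ξ‖ = 1) :
    1 / (480 * dist p q * (|Real.log (dist p q / dist q' q)| + 3 * Real.pi))
      ≤ kobayashiMetric Ω p ξ := by
  have hδ : 0 < dist p q := dist_pos.2 fun h => hq (h ▸ hp)
  -- Nonemptiness matters: the real `sInf` of the empty set is `0`.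
  refine le_csInf (kobayashiMetric_candidates_nonempty hΩ hp ξ) ?_
  rintro α ⟨hα, f, hf, hfm, rfl, rfl⟩
  have h := norm_deriv_zero_le_of_omits_two_points hqq hf
    (fun z hz h => hq (h ▸ hfm hz)) (fun z hz h => hq' (h ▸ hfm hz))
  rw [norm_smul, Complex.norm_real, Real.norm_of_nonneg hα.le] at hξ
  rw [div_le_iff₀ (by positivity), ← hξ]
  gcongr

/-! ### Discreteness of `J` and the final estimate -/

theorem isOpen_diff_of_forall_not_accPt {U J : Set ℂ} (hUo : IsOpen U)
    (hJd : ∀ z ∈ U, ¬ AccPt z (Filter.principal J)) : IsOpen (U \ J) := by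
  rw [isOpen_iff_mem_nhds]
  rintro z ⟨hzU, hzJ⟩
  have h := hJd z hzU
  rw [accPt_iff_frequently, Filter.not_frequently] at h
  filter_upwards [h, hUo.mem_nhds hzU] with y hy hyU
  refine ⟨hyU, fun hyJ => hy ⟨?_, hyJ⟩⟩
  rintro rfl
  exact hzJ hyJ

theorem exists_punctured_ball_subset_diff {U J : Set ℂ} (hUo : IsOpen U) {q : ℂ} (hqU : q ∈ U)
    (hq : ¬ AccPt q (Filter.principal J)) :
    ∃ r, 0 < r ∧ r < 1 ∧ Metric.ball q r \ {q} ⊆ U \ J := by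
  rw [accPt_iff_frequently, Filter.not_frequently] at hq
  obtain ⟨s, hs, hsub⟩ := Metric.eventually_nhds_iff_ball.1 (hq.and (hUo.mem_nhds hqU))
  refine ⟨min s (1 / 2), by positivity, (min_le_right _ _).trans_lt (by norm_num), ?_⟩
  rintro z ⟨hz, hzq⟩
  have h := hsub z (Metric.ball_subset_ball (min_le_left _ _) hz)
  exact ⟨h.2, fun hzJ => h.1 ⟨hzq, hzJ⟩⟩

theorem mainTheorem7 (U J : Set ℂ) (hUo : IsOpen U) (hUc : IsConnected U)
    (hJU : J ⊆ U) (hJ : J.Nontrivial)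
    (hJd : ∀ z ∈ U, ¬ AccPt z (Filter.principal J))
    (q : ℂ) (hq : q ∈ J) :
    ∃ c C δ₀ : ℝ, 0 < c ∧ 0 < C ∧ 0 < δ₀ ∧ δ₀ < 1 ∧
      ∀ p ∈ U \ J, ∀ ξ : ℂ, dist p q < δ₀ → ‖ξ‖ = 1 →
        c * (1 / (dist p q * Real.log (1 / dist p q))) ≤ kobayashiMetric (U \ J) p ξ ∧
        kobayashiMetric (U \ J) p ξ ≤ C * (1 / (dist p q * Real.log (1 / dist p q))) := by
  obtain ⟨q', hq', hqq⟩ := hJ.exists_ne q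
  obtain ⟨r, hr0, hr1, hr⟩ := exists_punctured_ball_subset_diff hUo (hJU hq) (hJd q (hJU hq))
  have hd : 0 < dist q' q := dist_pos.2 hqq
  set M := 1 + |Real.log (dist q' q)| + 3 * Real.pi with hM
  have hM0 : 0 < M := by positivity
  -- `δ < r²` gives `2 log (r/δ) ≥ log (1/δ)`, so `C = 1` works; `δ < 1/e` gives `log (1/δ) ≥ 1`, so
  -- the additive constants are absorbed into `M`.
  refine ⟨1 / (480 * M), 1, min (r ^ 2) (Real.exp (-1)), by positivity, one_pos, by positivity,
    (min_le_right _ _).trans_lt (by simp), ?_⟩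
  intro p hp ξ hpδ hξ
  have hpq : p ≠ q := fun h => hp.2 (h ▸ hq)
  have hδ : 0 < dist p q := dist_pos.2 hpq
  have hδr : dist p q < r ^ 2 := hpδ.trans_le (min_le_left _ _)
  have hδe : dist p q < Real.exp (-1) := hpδ.trans_le (min_le_right _ _)
  have hlogr : Real.log (dist p q) ≤ 2 * Real.log r := by
    have := Real.log_le_log hδ hδr.le
    rwa [Real.log_pow, Nat.cast_ofNat] at this
  have hloge : Real.log (dist p q) ≤ -1 := by
    have := Real.log_le_log hδ hδe.le
    rwa [Real.log_exp] at this
  rw [one_div (dist p q), Real.log_inv]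
  set l := Real.log (dist p q) with hl
  have hl0 : 0 < -l := by linarith
  constructor
  · refine le_trans ?_ (le_kobayashiMetric_of_omits_two_points
      (isOpen_diff_of_forall_not_accPt hUo hJd) hqq (fun h => h.2 hq) (fun h => h.2 hq') hp hξ)
    rw [div_mul_div_comm, one_mul]
    refine one_div_le_one_div_of_le (by positivity) ?_
    have h1 : |Real.log (dist p q / dist q' q)| ≤ -l + |Real.log (dist q' q)| := by
      rw [Real.log_div hδ.ne' hd.ne', ← hl]
      refine (abs_sub _ _).trans_eq ?_
      rw [abs_of_neg (by linarith)]
    have h2 : |Real.log (dist p q / dist q' q)| + 3 * Real.pi ≤ M * -l := by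
      have h3 : 0 ≤ |Real.log (dist q' q)| + 3 * Real.pi := by positivity
      rw [hM]
      nlinarith
    calc _ ≤ 480 * dist p q * (M * -l) := by gcongr
      _ = _ := by ring
  · have hpr : dist p q < r := hδr.trans (by nlinarith)
    refine (kobayashiMetric_le_of_punctured_ball_subset hr0 hr hpq hpr hξ).trans ?_
    rw [one_mul, Real.log_div hr0.ne' hδ.ne', ← hl]
    refine one_div_le_one_div_of_le (by positivity) ?_
    calc dist p q * -l ≤ dist p q * (2 * (Real.log r - l)) := by gcongr; linarith
      _ = _ := by ring
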